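/- Let $(\Pi_\kappa,[\cdot,\cdot])$ be a separable complex Pontryagin space with $\kappa\in\{0,1,2,\dots\}$ negative squares; topological notions refer to its Hilbert space topology. Fix a canonical symmetry $J$, so that $[x,y]=\langle Jx,y\rangle$ for a Hilbert inner product $\langle\cdot,\cdot\rangle$. Operators are linear and need not be densely defined. An operator $T$ is $\pi$-symmetric if $[Tx,y]=[x,Ty]$ for all $x,y\in\operatorname{dom}T$, and $\pi$-dissipative if $\operatorname{Im}[Tx,x]\ge 0$ for all $x\in\operatorname{dom}T$; $T^c$ is the adjoint linear relation with respect to $[\cdot,\cdot]$, and the defect numbers of a $\pi$-symmetric $T$ are $d_\pm=\dim\ker(JT^c\mp iI)$. A point $\lambda\in\mathbb C$ belongs to $r(T)$ (points of regular type) if $\|(T-\lambda)x\|\ge c\|x\|$ on $\operatorname{dom}T$ for some $c>0$, and to the resolvent set $\rho(T)$ if moreover $\operatorname{ran}(T-\lambda)=\Pi_\kappa$. Write $\mathbb C_*=\mathbb C\setminus\mathbb R$ and $U^*=\{\lambda:\bar\lambda\in U\}$; $\rho^*(T)=\rho(T)^*$. Let $A$ be a closed $\pi$-symmetric operator of class $(LP)$: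 $\operatorname{dom}A+\operatorname{ran}A$ is dense, and there is a canonical decomposition $\Pi_\kappa=\Pi^-[\oplus]\Pi^+$ with negative subspace $\Pi^-\subseteq\operatorname{dom}A$. Fix such a decomposition, let $P^\pm$ be its canonical projections, and let $\|AP^-\|$ be the operator norm for the induced norm $\|x\|^2=[P^+x,P^+x]-[P^-x,P^-x]$. Let $\Gamma_A$ be the union of all open sets $U\subseteq\mathbb C_*$ with $U=-U=U^*$ such that $\mathbb C^-\cap U\subseteq r(S)$ for every $\pi$-dissipative operator $S$ that extends $A$ or $-A$, and put $C_A=\mathbb C_*\setminus\Gamma_A$. Then $\Gamma_A$ is itself such a set, and $\{\lambda:|\operatorname{Im}\lambda|>t_0\|AP^-\|\}\subseteq\Gamma_A$ with $t_0\approx1.84$ (namely, for every real $t_0$ with $|t_0-1.84|\le 0.005$). If $\tilde A\supseteq A$ is a closed maximal $\pi$-symmetric operator with defect numbers $(d_+,0)$, $d_+\ge1$ (possibly $d_+=\infty$), then $$\mathbb R\cap\rho(\tilde A)=\mathbb R\cap r(\tilde A),\qquad \mathbb C^+\cap\rho(\tilde A)\supseteq\mathbb C^+\cap\Gamma_A,\qquad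 \mathbb C^-\cap\rho(\tilde A)\subseteq\mathbb C^-\cap C_A,$$ and $\rho(\tilde A)\cap\rho^*(\tilde A)=\emptyset$. -/

import Mathlib

open Set Topology

noncomputable section

namespace Pontryagin

variable {H : Type*} [NormedAddCommGroup H] [InnerProductSpace ℂ H]

/-- The indefinite metric `[x, y] = ⟨J x, y⟩`, linear in `x` and antilinear in `y`, of the
`J`-space `H`. -/
def form (J : H →L[ℂ] H) (x y : H) : ℂ := inner ℂ y (J x)

/-- `H` with the metric `[x, y] = ⟨J x, y⟩` is a Pontryagin space with `κ` negative squares: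
`J` is a canonical symmetry (`J = J⁻¹ = J*`) whose eigenspace at `-1` has dimension `κ`. -/
structure IsPontryaginSpace [CompleteSpace H] (J : H →L[ℂ] H) (κ : ℕ) : Prop where
  isSelfAdjoint : IsSelfAdjoint J
  involutive : ∀ x, J (J x) = x
  rank_neg : Module.rank ℂ (Module.End.eigenspace (J : H →ₗ[ℂ] H) (-1)) = κ

/-- A canonical decomposition `Π⁻ [⊕] Π⁺` of a Pontryagin space into a negative and a positive
subspace that are orthogonal in the indefinite metric. (The space has finitely many negative
squares, so both summands are then automatically complete in their intrinsic norms.) -/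
structure CanonicalDecomposition (J : H →L[ℂ] H) where
  neg : Submodule ℂ H
  pos : Submodule ℂ H
  isCompl : IsCompl neg pos
  orthogonal : ∀ x ∈ neg, ∀ y ∈ pos, form J x y = 0
  neg_def : ∀ x ∈ neg, x ≠ 0 → (form J x x).re < 0
  pos_def : ∀ x ∈ pos, x ≠ 0 → 0 < (form J x x).re

namespace CanonicalDecomposition

variable {J : H →L[ℂ] H} (D : CanonicalDecomposition J)

/-- The canonical projection `P⁻` onto `Π⁻` along `Π⁺`. -/
def projNeg : H →ₗ[ℂ] D.neg := Submodule.projectionOnto D.neg D.pos D.isCompl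

/-- The canonical projection `P⁺` onto `Π⁺` along `Π⁻`. -/
def projPos : H →ₗ[ℂ] D.pos := Submodule.projectionOnto D.pos D.neg D.isCompl.symm

/-- The norm induced by the canonical decomposition,
`‖x‖² = [P⁺ x, P⁺ x] - [P⁻ x, P⁻ x]`. -/
def norm (x : H) : ℝ :=
  Real.sqrt ((form J (D.projPos x) (D.projPos x)).re - (form J (D.projNeg x) (D.projNeg x)).re)

/-- For an operator `A` with `Π⁻ ⊆ dom A`, the operator norm of `A P⁻` with respect to the norm
induced by the canonical decomposition. -/
def normMulProjNeg (A : H →ₗ.[ℂ] H) (hA : D.neg ≤ A.domain) : ℝ :=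
  sInf {c : ℝ | 0 ≤ c ∧
    ∀ x : H, D.norm (A ⟨(D.projNeg x : H), hA (D.projNeg x).2⟩) ≤ c * D.norm x}

end CanonicalDecomposition

/-- `T` is `π`-symmetric: `[T x, y] = [x, T y]` on `dom T` (which need not be dense). -/
def IsSymmetric (J : H →L[ℂ] H) (T : H →ₗ.[ℂ] H) : Prop :=
  ∀ x y : T.domain, form J (T x) y = form J x (T y)

/-- `T` is `π`-dissipative: `Im [T x, x] ≥ 0` on `dom T`. -/
def IsDissipative (J : H →L[ℂ] H) (T : H →ₗ.[ℂ] H) : Prop :=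
  ∀ x : T.domain, 0 ≤ (form J (T x) x).im

/-- `T` is maximal `π`-symmetric: it has no proper `π`-symmetric extension. -/
def IsMaximalSymmetric (J : H →L[ℂ] H) (T : H →ₗ.[ℂ] H) : Prop :=
  IsSymmetric J T ∧ ∀ S : H →ₗ.[ℂ] H, IsSymmetric J S → T ≤ S → S = T

/-- The adjoint `T^c` with respect to the indefinite metric, as a linear relation. -/
def adjointRel (J : H →L[ℂ] H) (T : H →ₗ.[ℂ] H) : Submodule ℂ (H × H) where
  carrier := {p | ∀ x : T.domain, form J (T x) p.1 = form J x p.2}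
  zero_mem' := by intro x; simp [form]
  add_mem' := by
    intro p q hp hq x
    have h1 := hp x
    have h2 := hq x
    simp only [form, Prod.fst_add, Prod.snd_add, inner_add_left] at h1 h2 ⊢
    rw [h1, h2]
  smul_mem' := by
    intro c p hp x
    have h1 := hp x
    simp only [form, Prod.smul_fst, Prod.smul_snd, inner_smul_left] at h1 ⊢
    rw [h1]

/-- The defect subspace `Ker (J T^c - z I)`. -/
def defectSpace (J : H →L[ℂ] H) (T : H →ₗ.[ℂ] H) (z : ℂ) : Submodule ℂ H where
  carrier := {x | ∃ y, (x, y) ∈ adjointRel J T ∧ J y = z • x}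
  zero_mem' := ⟨0, (adjointRel J T).zero_mem, by simp⟩
  add_mem' := by
    rintro x x' ⟨y, hy, hJ⟩ ⟨y', hy', hJ'⟩
    exact ⟨y + y', (adjointRel J T).add_mem hy hy', by rw [map_add, hJ, hJ', smul_add]⟩
  smul_mem' := by
    rintro c x ⟨y, hy, hJ⟩
    exact ⟨c • y, (adjointRel J T).smul_mem c hy, by rw [map_smul, hJ, smul_comm]⟩

/-- The defect number `d₊ = dim Ker (J T^c - i I)`. -/
def defectPlus (J : H →L[ℂ] H) (T : H →ₗ.[ℂ] H) : ℕ∞ :=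
  Cardinal.toENat (Module.rank ℂ (defectSpace J T Complex.I))

/-- The defect number `d₋ = dim Ker (J T^c + i I)`. -/
def defectMinus (J : H →L[ℂ] H) (T : H →ₗ.[ℂ] H) : ℕ∞ :=
  Cardinal.toENat (Module.rank ℂ (defectSpace J T (-Complex.I)))

/-- The set `r(T)` of points of regular type: `T - z I` is injective with bounded inverse on its
range. -/
def regularType (T : H →ₗ.[ℂ] H) : Set ℂ :=
  {z | ∃ c : ℝ, 0 < c ∧ ∀ x : T.domain, c * ‖(x : H)‖ ≤ ‖T x - z • (x : H)‖}

/-- The resolvent set `ρ(T)`: `(T - z I)⁻¹` is a bounded everywhere defined operator. -/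
def resolventSet (T : H →ₗ.[ℂ] H) : Set ℂ :=
  {z | z ∈ regularType T ∧ ∀ y : H, ∃ x : T.domain, T x - z • (x : H) = y}

/-- The open upper half-plane `ℂ⁺`. -/
def upperHalf : Set ℂ := {z | 0 < z.im}

/-- The open lower half-plane `ℂ⁻`. -/
def lowerHalf : Set ℂ := {z | z.im < 0}

/-- The real line in `ℂ`. -/
def realLine : Set ℂ := {z | z.im = 0}

/-- The non-real numbers `ℂ_*`. -/
def nonReal : Set ℂ := {z | z.im ≠ 0}

/-- The reflected set `U* = {z | conj z ∈ U}`. -/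
def conjSet (U : Set ℂ) : Set ℂ := {z | (starRingEnd ℂ) z ∈ U}

/-- `A ∈ (P)`: the lineal `dom A + ran A` is dense. -/
def ClassP (A : H →ₗ.[ℂ] H) : Prop :=
  Dense ((A.domain ⊔ LinearMap.range A.toFun : Submodule ℂ H) : Set H)

/-- `A ∈ (L)`: some canonical decomposition has its negative subspace inside `dom A`. -/
def ClassL (J : H →L[ℂ] H) (A : H →ₗ.[ℂ] H) : Prop :=
  ∃ D : CanonicalDecomposition J, D.neg ≤ A.domain

/-- `A ∈ (LP)`: a closed `π`-symmetric operator that belongs to `(P)` and to `(L)`. -/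
structure ClassLP (J : H →L[ℂ] H) (A : H →ₗ.[ℂ] H) : Prop where
  isClosed : A.IsClosed
  isSymmetric : IsSymmetric J A
  classP : ClassP A
  classL : ClassL J A

/-- `U` is an open set of non-real numbers with `U = -U = U*` such that `ℂ⁻ ∩ U` consists of
points of regular type of every `π`-dissipative extension of `A`, and likewise of every
`π`-dissipative extension of `-A`. -/
structure IsAdmissible (J : H →L[ℂ] H) (A : H →ₗ.[ℂ] H) (U : Set ℂ) : Prop where
  isOpen : IsOpen U
  nonReal : U ⊆ nonReal
  neg_mem : ∀ z ∈ U, -z ∈ U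
  conj_mem : ∀ z ∈ U, (starRingEnd ℂ) z ∈ U
  regular : ∀ S : H →ₗ.[ℂ] H, A ≤ S → IsDissipative J S → lowerHalf ∩ U ⊆ regularType S
  regular_neg : ∀ S : H →ₗ.[ℂ] H, -A ≤ S → IsDissipative J S → lowerHalf ∩ U ⊆ regularType S

/-- The set `Γ_A`: the largest open subset of `ℂ_*`, symmetric in the sense
`Γ_A = -Γ_A = Γ_{-A} = Γ_A*`, for which `ℂ⁻ ∩ Γ_A ⊆ r(S)` for all `π`-dissipative extensions
`S` of `A`. -/
def GammaSet (J : H →L[ℂ] H) (A : H →ₗ.[ℂ] H) : Set ℂ :=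
  ⋃₀ {U | IsAdmissible J A U}

/-- The set `C_A = ℂ_* ∖ Γ_A`. -/
def CSet (J : H →L[ℂ] H) (A : H →ₗ.[ℂ] H) : Set ℂ := nonReal \ GammaSet J A

end Pontryagin

end

/-! Everything is moved to the Hilbert space: if `B` is π-symmetric, `J B` is symmetric, and so is
`J B - α J` for real `α`. For `z = α + i η`, `J (B - z) = (J B - α J - i η) - i η (J - 1)`. The
bracket is bounded below by `|η|`, so its surjectivity does not change while `α` runs over `ℝ` and
`η` over one open half-line (stability of surjectivity under small perturbations). The remainder has
finite rank, so at a non-real point of regular type, where both operators are injective, one is onto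
exactly when the other is. A real point of regular type is joined to both half-planes by a small
shift. Hence surjectivity of `B - z` at a point of regular type is decided at `J B ∓ i`. Since `d₋ =
0` and `B` is closed, `J B - i` is onto; since `d₊ ≥ 1`, `J B + i` is not. So points of regular type
in the closed upper half-plane are resolvent points, and `ρ(B)` lies in the open upper half-plane.
The four spectral claims follow, because `Γ_A` consists of points of regular type of every symmetric
extension of `A`.

For the strip estimate let `S` be a dissipative extension of `±A`. On `Π⁻` the form `[S n, n]` is
real, which forces `[S p, n] = [p, S n]`. With `x = n + p` and `f = (S - z) x`, the imaginary parts
of `[f, p]` and `[f, n]` give two coupled inequalities that bound `x` by `f` once `-Im z > ‖A P⁻‖`.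
Thus already the constant `1` works in place of `1.84`. -/

namespace Pontryagin

/-! ### Stability of surjectivity for operators bounded below -/

section BoundedBelow

variable {H : Type*} [NormedAddCommGroup H] [InnerProductSpace ℂ H]
  {E : Type*} [AddCommGroup E] [Module ℂ E]

/-- An operator `T` with a domain `ι : E → H` that is onto and bounded below has a bounded
inverse. -/
theorem exists_inverse_of_surjective {ι T : E →ₗ[ℂ] H} {c : ℝ} (hc : 0 < c)
    (hT : ∀ x, c * ‖ι x‖ ≤ ‖T x‖) (hs : Function.Surjective T) :
    ∃ R : H →L[ℂ] H, ‖R‖ ≤ c⁻¹ ∧ ∀ y, ∃ x, T x = y ∧ ι x = R y := by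
  choose r hr using hs
  have key : ∀ x, T x = 0 → ι x = 0 := by
    intro x hx
    have h := hT x
    rw [hx, norm_zero] at h
    exact norm_le_zero_iff.1 (nonpos_of_mul_nonpos_right h hc)
  let R₀ : H →ₗ[ℂ] H :=
    { toFun := fun y => ι (r y)
      map_add' := fun y z => by
        have := key (r (y + z) - r y - r z) (by simp [hr])
        rw [map_sub, map_sub, sub_sub, sub_eq_zero] at this
        exact this
      map_smul' := fun a y => by
        have := key (r (a • y) - a • r y) (by simp [hr])
        rw [map_sub, map_smul, sub_eq_zero] at this
        exact this }
  have hR : ∀ y, ‖R₀ y‖ ≤ c⁻¹ * ‖y‖ := by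
    intro y
    have h := hT (r y)
    rw [hr] at h
    rw [inv_mul_eq_div, le_div_iff₀ hc, mul_comm]
    exact h
  exact ⟨R₀.mkContinuous c⁻¹ hR, R₀.mkContinuous_norm_le (inv_nonneg.2 hc.le) hR,
    fun y => ⟨r y, hr y, rfl⟩⟩

/-- Surjectivity of an operator that is bounded below is stable under small perturbations. -/
theorem surjective_sub_of_norm_lt [CompleteSpace H] {ι T : E →ₗ[ℂ] H} {c : ℝ}
    (hT : ∀ x, c * ‖ι x‖ ≤ ‖T x‖) (hs : Function.Surjective T) {M : H →L[ℂ] H} (hM : ‖M‖ < c) :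
    Function.Surjective (T - (M : H →ₗ[ℂ] H) ∘ₗ ι) := by
  have hc : 0 < c := (norm_nonneg M).trans_lt hM
  obtain ⟨R, hR, hRT⟩ := exists_inverse_of_surjective hc hT hs
  have hMR : ‖M * R‖ < 1 := by
    calc ‖M * R‖ ≤ ‖M‖ * ‖R‖ := norm_mul_le _ _
      _ ≤ ‖M‖ * c⁻¹ := by gcongr
      _ < c * c⁻¹ := by gcongr
      _ = 1 := mul_inv_cancel₀ hc.ne'
  -- If `T x = v` and `ι x = R v`, then `(T - M ι) x = (1 - M R) v`, and `1 - M R` is invertible by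
  -- the Neumann series.
  obtain ⟨u, hu⟩ := isUnit_one_sub_of_norm_lt_one hMR
  intro y
  have hy : (1 - M * R) ((↑u⁻¹ : H →L[ℂ] H) y) = y := by
    rw [← hu, ← mul_apply_eq_comp, u.mul_inv]; rfl
  obtain ⟨x, hx, hx'⟩ := hRT ((↑u⁻¹ : H →L[ℂ] H) y)
  refine ⟨x, ?_⟩
  rw [LinearMap.sub_apply, LinearMap.comp_apply, hx, hx']
  exact hy

/-- Surjectivity is constant along a segment of perturbations that are uniformly bounded below. -/
theorem surjective_of_segment [CompleteSpace H] {ι T : E →ₗ[ℂ] H} {M₀ M₁ : H →L[ℂ] H} {c : ℝ}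
    (hc : 0 < c)
    (hT : ∀ s ∈ Icc (0 : ℝ) 1, ∀ x, c * ‖ι x‖ ≤ ‖T x - (M₀ + (s : ℂ) • (M₁ - M₀)) (ι x)‖)
    (hs : Function.Surjective (T - (M₀ : H →ₗ[ℂ] H) ∘ₗ ι)) :
    Function.Surjective (T - (M₁ : H →ₗ[ℂ] H) ∘ₗ ι) := by
  -- The segment is cut into `n` pieces, each of norm below the uniform lower bound `c`.
  obtain ⟨n, hn⟩ := exists_nat_gt (‖M₁ - M₀‖ / c)
  have hn0 : (0 : ℝ) < n := lt_of_le_of_lt (by positivity) hn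
  have step : ∀ k : ℕ, k ≤ n → Function.Surjective
      (T - ((M₀ + ((k / n : ℝ) : ℂ) • (M₁ - M₀) : H →L[ℂ] H) : H →ₗ[ℂ] H) ∘ₗ ι) := by
    intro k
    induction k with
    | zero => intro _; simpa using hs
    | succ k ih =>
      intro hk
      have hk' : (k : ℝ) ≤ n := by exact_mod_cast (Nat.le_succ k).trans hk
      have h := surjective_sub_of_norm_lt (c := c)
        (M := ((1 / n : ℝ) : ℂ) • (M₁ - M₀))
        (hT (k / n) ⟨by positivity, (div_le_one hn0).2 hk'⟩) (ih (Nat.le_of_succ_le hk)) ?_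
      · convert h using 2
        ext x
        simp only [LinearMap.sub_apply, LinearMap.comp_apply, ContinuousLinearMap.coe_coe,
          add_apply, smul_apply]
        have : (((k + 1 : ℕ) / n : ℝ) : ℂ) = ((k / n : ℝ) : ℂ) + ((1 / n : ℝ) : ℂ) := by
          push_cast; ring
        rw [this, add_smul]
        abel
      · rw [norm_smul, Complex.norm_real, Real.norm_of_nonneg (by positivity), one_div,
          inv_mul_eq_div, div_lt_iff₀ hn0]
        rwa [div_lt_iff₀ hc, mul_comm] at hn
  have h := step n le_rfl
  rw [div_self hn0.ne'] at h
  simpa using h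

/-- A finite rank perturbation of a bijective operator is onto as soon as it is injective. -/
theorem surjective_sub_of_finiteDimensional {ι T : E →ₗ[ℂ] H} {c : ℝ} (hc : 0 < c)
    (hT : ∀ x, c * ‖ι x‖ ≤ ‖T x‖) (hs : Function.Surjective T) {F : H →ₗ[ℂ] H}
    [FiniteDimensional ℂ (LinearMap.range F)] (hF : ∀ x, T x - F (ι x) = 0 → ι x = 0) :
    Function.Surjective (T - F ∘ₗ ι) := by
  obtain ⟨R, -, hRT⟩ := exists_inverse_of_surjective hc hT hs
  -- `G = 1 - F R` preserves the finite-dimensional range of `F`, where injectivity gives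
  -- surjectivity. Solving `G v = F R y` there yields `G (y + v) = y`.
  let G : H →ₗ[ℂ] H := LinearMap.id - F ∘ₗ (R : H →ₗ[ℂ] H)
  have hG : ∀ y, G y = y - F (R y) := fun y => rfl
  have hmem : ∀ v ∈ LinearMap.range F, G v ∈ LinearMap.range F := fun v hv =>
    Submodule.sub_mem _ hv ⟨_, rfl⟩
  have hinj : Function.Injective (G.restrict hmem) := by
    rw [← LinearMap.ker_eq_bot, LinearMap.ker_eq_bot']
    rintro ⟨v, hv⟩ h
    have h0 : v - F (R v) = 0 := congrArg Subtype.val h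
    obtain ⟨x, hx, hx'⟩ := hRT v
    have := hF x (by rw [hx, hx', h0])
    rw [← hx', this, map_zero, sub_zero] at h0
    exact Subtype.ext h0
  have hsurj := LinearMap.surjective_of_injective hinj
  intro y
  obtain ⟨⟨v, hv⟩, h⟩ := hsurj ⟨F (R y), ⟨_, rfl⟩⟩
  have h0 : v - F (R v) = F (R y) := congrArg Subtype.val h
  obtain ⟨x, hx, hx'⟩ := hRT (y + v)
  refine ⟨x, ?_⟩
  rw [LinearMap.sub_apply, LinearMap.comp_apply, hx, hx', map_add, map_add, ← h0]
  abel

end BoundedBelow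

/-! ### Imaginary shifts of Hilbert space symmetric operators -/

section Symmetric

variable {H : Type*} [NormedAddCommGroup H] [InnerProductSpace ℂ H]
  {E : Type*} [AddCommGroup E] [Module ℂ E]

/-- A symmetric operator shifted by `i η` is bounded below by `|η|`. -/
theorem abs_mul_norm_le_of_symmetric {x y : H} (h : (inner ℂ x y).im = 0) (η : ℝ) :
    |η| * ‖x‖ ≤ ‖y - (η * Complex.I) • x‖ := by
  have h1 : (inner ℂ x (y - (η * Complex.I) • x)).im = -(η * ‖x‖ ^ 2) := by
    rw [inner_sub_right, inner_smul_right, inner_self_eq_norm_sq_to_K, Complex.sub_im, h]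
    simp [← Complex.ofReal_pow]
  have h2 : |η| * ‖x‖ ^ 2 ≤ ‖x‖ * ‖y - (η * Complex.I) • x‖ := by
    calc |η| * ‖x‖ ^ 2 = |(inner ℂ x (y - (η * Complex.I) • x)).im| := by
          rw [h1, abs_neg, abs_mul, abs_of_nonneg (sq_nonneg ‖x‖)]
      _ ≤ _ := (Complex.abs_im_le_norm _).trans (norm_inner_le_norm _ _)
  rcases (norm_nonneg x).eq_or_lt with h0 | h0
  · rw [← h0, mul_zero]; positivity
  · nlinarith

/-- For a symmetric operator `K`, surjectivity of `K - N - i η` depends neither on the bounded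
self-adjoint operator `N` nor on `η` in a half-line. -/
theorem surjective_of_symmetric [CompleteSpace H] {ι K : E →ₗ[ℂ] H}
    (hK : ∀ x, (inner ℂ (ι x) (K x)).im = 0) {N₀ N₁ : H →L[ℂ] H}
    (h₀ : ∀ x, (inner ℂ x (N₀ x)).im = 0) (h₁ : ∀ x, (inner ℂ x (N₁ x)).im = 0)
    {η₀ η₁ : ℝ} (hη : 0 < η₀ * η₁)
    (hs : ∀ y, ∃ x, K x - N₀ (ι x) - (η₀ * Complex.I) • ι x = y) :
    ∀ y, ∃ x, K x - N₁ (ι x) - (η₁ * Complex.I) • ι x = y := by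
  have h := surjective_of_segment (T := K) (ι := ι) (c := min |η₀| |η₁|)
    (M₀ := N₀ + (η₀ * Complex.I) • 1) (M₁ := N₁ + (η₁ * Complex.I) • 1) ?_ ?_ ?_
  · intro y
    obtain ⟨x, hx⟩ := h y
    refine ⟨x, ?_⟩
    rw [← hx]
    simp [sub_sub]
  · have h0 : η₀ ≠ 0 := by rintro rfl; simp at hη
    have h1 : η₁ ≠ 0 := by rintro rfl; simp at hη
    positivity
  · rintro s ⟨hs0, hs1⟩ x
    have hsym : (inner ℂ (ι x)
        (K x - N₀ (ι x) - (s : ℂ) • (N₁ (ι x) - N₀ (ι x)))).im = 0 := by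
      rw [inner_sub_right, inner_sub_right, inner_smul_right, inner_sub_right, Complex.sub_im,
        Complex.sub_im, Complex.im_ofReal_mul, hK, h₀]
      simp [h₀, h₁]
    have := abs_mul_norm_le_of_symmetric hsym (η₀ + s * (η₁ - η₀))
    refine (mul_le_mul_of_nonneg_right ?_ (norm_nonneg _)).trans (this.trans_eq ?_)
    -- `η₀` and `η₁` have the same sign, so every shift between them has modulus at least `min |η₀|
    -- |η₁|`.
    · rcases mul_pos_iff.1 hη with ⟨a, b⟩ | ⟨a, b⟩
      · rw [abs_of_pos a, abs_of_pos b]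
        refine le_trans ?_ (le_abs_self _)
        rcases min_cases η₀ η₁ with h | h <;> nlinarith
      · rw [abs_of_neg a, abs_of_neg b]
        refine le_trans ?_ (neg_le_abs _)
        rcases min_cases (-η₀) (-η₁) with h | h <;> nlinarith
    · congr 1
      simp only [add_apply, smul_apply,
        sub_apply, one_apply_eq_self]
      push_cast
      module
  · intro y
    obtain ⟨x, hx⟩ := hs y
    refine ⟨x, ?_⟩
    rw [← hx]
    simp [sub_sub]

end Symmetric

/-! ### Defect spaces and the splitting of `J (B - z)` -/

section Basic

variable {H : Type*} [NormedAddCommGroup H] [InnerProductSpace ℂ H] {J : H →L[ℂ] H}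
  {B : H →ₗ.[ℂ] H}

theorem defectSpace_eq_bot_of_toENat {z : ℂ}
    (h : Cardinal.toENat (Module.rank ℂ (defectSpace J B z)) = 0) : defectSpace J B z = ⊥ := by
  rwa [Cardinal.toENat_eq_zero, Submodule.rank_eq_zero] at h

/-- Trading `J` for `1` in the imaginary part of the shift leaves a symmetric operator shifted by `i
Im z`, at the cost of a multiple of `J - 1`, which has finite rank in a Pontryagin space. -/
theorem map_sub_smul_eq (z : ℂ) (x y : H) :
    J (y - z • x) =
      J y - (z.re : ℂ) • J x - (z.im * Complex.I) • x - ((z.im * Complex.I) • (J - 1)) x := by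
  rw [smul_apply, sub_apply, one_apply_eq_self, map_sub, map_smul]
  conv_lhs => rw [← Complex.re_add_im z]
  module

end Basic

/-! ### Defect numbers, points of regular type and the resolvent set -/

section Resolvent

variable {H : Type*} [NormedAddCommGroup H] [InnerProductSpace ℂ H] [CompleteSpace H]
  {J : H →L[ℂ] H} {κ : ℕ}

namespace IsPontryaginSpace

theorem inner_map_left (hJ : IsPontryaginSpace J κ) (x y : H) :
    inner ℂ (J x) y = inner ℂ x (J y) := by
  rw [← ContinuousLinearMap.adjoint_inner_right, hJ.isSelfAdjoint.adjoint_eq]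

theorem norm_map (hJ : IsPontryaginSpace J κ) (x : H) : ‖J x‖ = ‖x‖ := by
  have h : inner ℂ (J x) (J x) = inner ℂ x x := by rw [hJ.inner_map_left, hJ.involutive]
  rw [inner_self_eq_norm_sq_to_K, inner_self_eq_norm_sq_to_K] at h
  have h' : ‖J x‖ ^ 2 = ‖x‖ ^ 2 := by exact_mod_cast h
  exact (sq_eq_sq₀ (norm_nonneg _) (norm_nonneg _)).1 h'

theorem form_conj (hJ : IsPontryaginSpace J κ) (x y : H) :
    (starRingEnd ℂ) (form J x y) = form J y x := by
  rw [form, form, inner_conj_symm, hJ.inner_map_left]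

theorem form_self_im (hJ : IsPontryaginSpace J κ) (x : H) : (form J x x).im = 0 :=
  Complex.conj_eq_iff_im.1 (hJ.form_conj x x)

theorem finiteDimensional_eigenspace (hJ : IsPontryaginSpace J κ) :
    FiniteDimensional ℂ (Module.End.eigenspace (J : H →ₗ[ℂ] H) (-1)) :=
  FiniteDimensional.of_rank_eq_nat hJ.rank_neg

/-- Since `J² = 1`, `J (J - 1) = -(J - 1)`, so the range lies in the eigenspace at `-1`. -/
theorem finiteDimensional_range_smul (hJ : IsPontryaginSpace J κ) (a : ℂ) :
    FiniteDimensional ℂ (LinearMap.range ((a • (J - 1) : H →L[ℂ] H) : H →ₗ[ℂ] H)) := by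
  have := hJ.finiteDimensional_eigenspace
  refine Submodule.finiteDimensional_of_le
    (S₂ := Module.End.eigenspace (J : H →ₗ[ℂ] H) (-1)) ?_
  rintro _ ⟨x, rfl⟩
  rw [Module.End.mem_eigenspace_iff]
  simp [hJ.involutive]
  rw [← smul_neg, neg_sub]

theorem surjective_comp_iff (hJ : IsPontryaginSpace J κ) {E : Type*} {f : E → H} :
    Function.Surjective (fun x => J (f x)) ↔ Function.Surjective f :=
  Function.Surjective.of_comp_iff' (Function.Involutive.bijective hJ.involutive) f

end IsPontryaginSpace

variable {B : H →ₗ.[ℂ] H}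

theorem IsSymmetric.form_self_im (hJ : IsPontryaginSpace J κ) (hB : IsSymmetric J B)
    (x : B.domain) : (form J (B x) x).im = 0 := by
  rw [← Complex.conj_eq_iff_im, hJ.form_conj, hB]

/-- The defect space at `z` is the Hilbert orthogonal complement of the range of `J B - conj z`; the
conjugation is why `d₋` controls `J B - i` and `d₊` controls `J B + i`. -/
theorem mem_defectSpace_iff (hJ : IsPontryaginSpace J κ) {z : ℂ} {w : H} :
    w ∈ defectSpace J B z ↔ ∀ x : B.domain,
      inner ℂ (J (B x) - (starRingEnd ℂ) z • (x : H)) w = 0 := by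
  have h1 : w ∈ defectSpace J B z ↔
      ∀ x : B.domain, inner ℂ w (J (B x)) = (starRingEnd ℂ) z * inner ℂ w (x : H) := by
    constructor
    · rintro ⟨y, hy, hJy⟩ x
      have h := hy x
      simp only [form] at h
      rw [h, ← hJ.inner_map_left, hJy, inner_smul_left]
    · intro h
      refine ⟨J (z • w), fun x => ?_, hJ.involutive _⟩
      simp only [form]
      rw [h, hJ.inner_map_left, hJ.involutive, inner_smul_left]
  rw [h1]
  refine forall_congr' fun x => ?_
  rw [← inner_eq_zero_symm, inner_sub_right, inner_smul_right, sub_eq_zero]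

theorem abs_mul_norm_le_shift (hJ : IsPontryaginSpace J κ) (hB : IsSymmetric J B) (α η : ℝ)
    (x : B.domain) :
    |η| * ‖(x : H)‖ ≤ ‖J (B x) - (α : ℂ) • J x - (η * Complex.I) • (x : H)‖ := by
  refine abs_mul_norm_le_of_symmetric ?_ η
  have h1 := hB.form_self_im hJ x
  have h2 := hJ.form_self_im x
  simp only [form] at h1 h2
  rw [inner_sub_right, inner_smul_right, Complex.sub_im, Complex.im_ofReal_mul, h1, h2]
  simp

/-- A closed symmetric operator with vanishing lower defect number: `J B - i` is onto. -/
theorem surjective_of_defectMinus_eq_zero (hJ : IsPontryaginSpace J κ) (hB : IsSymmetric J B)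
    (hc : B.IsClosed) (hd : defectMinus J B = 0) :
    ∀ y, ∃ x : B.domain, J (B x) - Complex.I • (x : H) = y := by
  let T : B.domain →ₗ[ℂ] H :=
    (J : H →ₗ[ℂ] H) ∘ₗ B.toFun - Complex.I • B.domain.subtype
  have hT : ∀ x : B.domain, T x = J (B x) - Complex.I • (x : H) := fun x => rfl
  have hbd : ∀ x : B.domain, ‖(x : H)‖ ≤ ‖T x‖ := by
    intro x
    have := abs_mul_norm_le_shift hJ hB 0 1 x
    simpa [hT] using this
  -- The lower bound makes preimages of a convergent sequence Cauchy, and the closed graph of `B`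
  -- captures their limit.
  have hclosed : IsClosed (LinearMap.range T : Set H) := by
    refine IsSeqClosed.isClosed ?_
    intro u y hu huy
    choose x hx using hu
    have hcau : CauchySeq fun n => (x n : H) := by
      have hcu := huy.cauchySeq
      rw [Metric.cauchySeq_iff'] at hcu ⊢
      intro ε hε
      obtain ⟨N, hN⟩ := hcu ε hε
      refine ⟨N, fun n hn => lt_of_le_of_lt ?_ (hN n hn)⟩
      rw [dist_eq_norm, dist_eq_norm, ← hx n, ← hx N, ← map_sub]
      exact hbd (x n - x N)
    obtain ⟨w, hw⟩ := cauchySeq_tendsto_of_complete hcau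
    have hBx : Filter.Tendsto (fun n => B (x n)) Filter.atTop (𝓝 (J (y + Complex.I • w))) := by
      have h := (J.continuous.tendsto _).comp (huy.add (hw.const_smul Complex.I))
      refine h.congr fun n => ?_
      simp only [Function.comp_apply]
      rw [← hx n, hT, sub_add_cancel, hJ.involutive]
    have hmem : (w, J (y + Complex.I • w)) ∈ (B.graph : Set (H × H)) :=
      IsClosed.mem_of_tendsto hc (hw.prodMk_nhds hBx)
        (Filter.Eventually.of_forall fun n => B.mem_graph (x n))
    obtain ⟨v, hv, hv'⟩ := (LinearPMap.mem_graph_iff B).1 hmem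
    refine ⟨v, ?_⟩
    simp only at hv hv'
    rw [hT, hv, hv', hJ.involutive, add_sub_cancel_right]
  have hort : (LinearMap.range T)ᗮ = ⊥ := by
    rw [eq_bot_iff, ← defectSpace_eq_bot_of_toENat hd]
    intro w hw
    rw [mem_defectSpace_iff hJ]
    intro x
    have := hw (T x) ⟨x, rfl⟩
    rwa [map_neg, Complex.conj_I, neg_neg]
  have : CompleteSpace (LinearMap.range T) := hclosed.completeSpace_coe
  have htop : LinearMap.range T = ⊤ := Submodule.orthogonal_eq_bot_iff.1 hort
  exact LinearMap.range_eq_top.1 htop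

/-- A symmetric operator with non-vanishing upper defect number: `J B + i` is not onto. -/
theorem not_surjective_of_defectPlus (hJ : IsPontryaginSpace J κ) (hd : 1 ≤ defectPlus J B) :
    ¬ ∀ y, ∃ x : B.domain, J (B x) + Complex.I • (x : H) = y := by
  intro h
  have hbot : defectSpace J B Complex.I = ⊥ := by
    rw [eq_bot_iff]
    intro w hw
    rw [mem_defectSpace_iff hJ] at hw
    obtain ⟨x, hx⟩ := h w
    have := hw x
    rw [Complex.conj_I, neg_smul, sub_neg_eq_add, hx] at this
    exact inner_self_eq_zero.1 this
  rw [defectPlus, hbot] at hd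
  simp at hd

theorem surjective_shift (hJ : IsPontryaginSpace J κ) (hB : IsSymmetric J B)
    (α₀ α₁ : ℝ) {η₀ η₁ : ℝ} (hη : 0 < η₀ * η₁)
    (hs : ∀ y, ∃ x : B.domain, J (B x) - (α₀ : ℂ) • J x - (η₀ * Complex.I) • (x : H) = y) :
    ∀ y, ∃ x : B.domain, J (B x) - (α₁ : ℂ) • J x - (η₁ * Complex.I) • (x : H) = y := by
  have him : ∀ (α : ℝ) (x : H), (inner ℂ x (((α : ℂ) • J) x)).im = 0 := by
    intro α x
    have h2 := hJ.form_self_im x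
    simp only [form] at h2
    rw [smul_apply, inner_smul_right, Complex.im_ofReal_mul, h2, mul_zero]
  exact surjective_of_symmetric (ι := B.domain.subtype) (K := (J : H →ₗ[ℂ] H) ∘ₗ B.toFun)
    (fun x => hB.form_self_im hJ x) (him α₀) (him α₁) hη hs

/-- At a non-real point of regular type, replacing `J` by `1` in the imaginary part of the shift
(a finite rank perturbation) does not affect surjectivity. -/
theorem surjective_sub_smul_iff (hJ : IsPontryaginSpace J κ) (hB : IsSymmetric J B) {z : ℂ}
    (hz : z.im ≠ 0) (hr : z ∈ regularType B) :
    (∀ y, ∃ x : B.domain, B x - z • (x : H) = y) ↔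
      ∀ y, ∃ x : B.domain,
        J (B x) - (z.re : ℂ) • J x - (z.im * Complex.I) • (x : H) = y := by
  obtain ⟨c, hc, hcx⟩ := hr
  let ι := B.domain.subtype
  let T : B.domain →ₗ[ℂ] H :=
    (J : H →ₗ[ℂ] H) ∘ₗ B.toFun - (z.re : ℂ) • (J : H →ₗ[ℂ] H) ∘ₗ ι - (z.im * Complex.I) • ι
  let S : B.domain →ₗ[ℂ] H := (J : H →ₗ[ℂ] H) ∘ₗ (B.toFun - z • ι)
  have hSx : ∀ x : B.domain, S x = J (B x - z • (x : H)) := fun x => rfl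
  have hT : ∀ x, |z.im| * ‖ι x‖ ≤ ‖T x‖ := abs_mul_norm_le_shift hJ hB z.re z.im
  have hS : ∀ x, c * ‖ι x‖ ≤ ‖S x‖ := by
    intro x
    rw [hSx, hJ.norm_map]
    exact hcx x
  have hST : ∀ x, S x = T x - ((z.im * Complex.I) • (J - 1)) (ι x) := fun x =>
    map_sub_smul_eq z _ _
  have hS0 : (∀ y, ∃ x : B.domain, B x - z • (x : H) = y) ↔ Function.Surjective S :=
    (hJ.surjective_comp_iff (f := B.toFun - z • ι)).symm
  rw [hS0]
  change _ ↔ Function.Surjective T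
  have hzero : ∀ {a b : ℝ} {v : H}, 0 < a → a * b ≤ ‖v‖ → v = 0 → b ≤ 0 := by
    rintro a b v ha h rfl
    rw [norm_zero] at h
    exact nonpos_of_mul_nonpos_right h ha
  constructor
  · intro h
    have := hJ.finiteDimensional_range_smul (-(z.im * Complex.I))
    have := surjective_sub_of_finiteDimensional hc hS h
      (F := (((-(z.im * Complex.I)) • (J - 1) : H →L[ℂ] H) : H →ₗ[ℂ] H)) ?_
    · have heq : S - (((-(z.im * Complex.I)) • (J - 1) : H →L[ℂ] H) : H →ₗ[ℂ] H) ∘ₗ ι = T := by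
        refine LinearMap.ext fun x => ?_
        rw [LinearMap.sub_apply, hST]
        simp
      rwa [heq] at this
    · intro x hx
      refine norm_le_zero_iff.1 (hzero (abs_pos.2 hz) (hT x) ?_)
      rw [← hx, hST]
      simp
  · intro h
    have := hJ.finiteDimensional_range_smul (z.im * Complex.I)
    have := surjective_sub_of_finiteDimensional (abs_pos.2 hz) hT h
      (F := (((z.im * Complex.I) • (J - 1) : H →L[ℂ] H) : H →ₗ[ℂ] H)) ?_
    · convert this using 2
      ext x
      rw [hST]
      rfl
    · intro x hx
      refine norm_le_zero_iff.1 (hzero hc (hS x) ?_)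
      rw [← hx, hST]
      rfl

/-- At a real point of regular type, surjectivity passes to and from nearby shifts. -/
theorem exists_shift_surjective_iff (hJ : IsPontryaginSpace J κ) {z : ℂ}
    (hz : z.im = 0) (hr : z ∈ regularType B) (σ : ℝ) (hσ : |σ| = 1) :
    ∃ ε : ℝ, 0 < ε ∧ ((∀ y, ∃ x : B.domain, B x - z • (x : H) = y) ↔
      ∀ y, ∃ x : B.domain,
        J (B x) - (z.re : ℂ) • J x - ((σ * ε : ℝ) * Complex.I) • (x : H) = y) := by
  obtain ⟨c, hc, hcx⟩ := hr
  let ι := B.domain.subtype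
  let S : B.domain →ₗ[ℂ] H := (J : H →ₗ[ℂ] H) ∘ₗ (B.toFun - z • ι)
  have hSx : ∀ x : B.domain, S x = J (B x - z • (x : H)) := fun x => rfl
  have hS : ∀ x, c * ‖ι x‖ ≤ ‖S x‖ := by
    intro x
    rw [hSx, hJ.norm_map]
    exact hcx x
  have hS0 : (∀ y, ∃ x : B.domain, B x - z • (x : H) = y) ↔ Function.Surjective S :=
    (hJ.surjective_comp_iff (f := B.toFun - z • ι)).symm
  have hSz : ∀ x : B.domain, S x = J (B x) - (z.re : ℂ) • J x := by
    intro x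
    rw [hSx, map_sub_smul_eq, hz]
    simp
  -- A shift of size `c / 3` leaves the lower bound `2 c / 3`, which still exceeds `c / 3`, so the
  -- shift can also be undone.
  let M : H →L[ℂ] H := ((σ * (c / 3) : ℝ) * Complex.I) • 1
  have hM : ‖M‖ ≤ c / 3 := by
    refine ContinuousLinearMap.opNorm_le_bound _ (by positivity) fun x => ?_
    simp only [M, smul_apply, one_apply_eq_self]
    rw [norm_smul, norm_mul, Complex.norm_I, Complex.norm_real, Real.norm_eq_abs, abs_mul, hσ,
      abs_of_pos (by positivity : 0 < c / 3)]
    linarith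
  refine ⟨c / 3, by positivity, ?_⟩
  rw [hS0]
  have hright : (∀ y, ∃ x : B.domain, J (B x) - (z.re : ℂ) • J x -
      ((σ * (c / 3) : ℝ) * Complex.I) • (x : H) = y) ↔
      Function.Surjective (S - (M : H →ₗ[ℂ] H) ∘ₗ ι) := by
    refine forall_congr' fun y => exists_congr fun x => ?_
    rw [LinearMap.sub_apply, hSz]
    rfl
  rw [hright]
  constructor
  · intro h
    exact surjective_sub_of_norm_lt hS h (by linarith)
  · intro h
    have hlow : ∀ x, (2 * c / 3) * ‖ι x‖ ≤ ‖(S - (M : H →ₗ[ℂ] H) ∘ₗ ι) x‖ := by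
      intro x
      have h1 := hS x
      have h2 : ‖M (ι x)‖ ≤ c / 3 * ‖ι x‖ := M.le_of_opNorm_le hM _
      have h3 : ‖S x‖ - ‖M (ι x)‖ ≤ ‖S x - M (ι x)‖ := norm_sub_norm_le _ _
      change _ ≤ ‖S x - M (ι x)‖
      linarith
    have := surjective_sub_of_norm_lt (M := -M) hlow h (by rw [norm_neg]; linarith)
    convert this using 2
    ext x
    simp

/-- Every point of regular type of `B` in the open upper half-plane is in the resolvent set if
`J B - i` is onto. -/
theorem mem_resolventSet_of_mem_regularType (hJ : IsPontryaginSpace J κ) (hB : IsSymmetric J B)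
    (hs : ∀ y, ∃ x : B.domain, J (B x) - Complex.I • (x : H) = y) {z : ℂ} (hz : 0 ≤ z.im)
    (hr : z ∈ regularType B) : z ∈ resolventSet B := by
  refine ⟨hr, ?_⟩
  have hs' : ∀ y, ∃ x : B.domain,
      J (B x) - ((0 : ℝ) : ℂ) • J x - ((1 : ℝ) * Complex.I) • (x : H) = y := by
    simpa using hs
  rcases hz.eq_or_lt with h0 | h0
  · obtain ⟨ε, hε, h⟩ := exists_shift_surjective_iff hJ h0.symm hr 1 (by simp)
    exact h.2 (surjective_shift hJ hB 0 z.re (by simpa using hε) hs')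
  · exact (surjective_sub_smul_iff hJ hB h0.ne' hr).2
      (surjective_shift hJ hB 0 z.re (by simpa using h0) hs')

/-- The resolvent set of `B` contains no point of the closed lower half-plane if `J B + i` is not
onto. -/
theorem im_pos_of_mem_resolventSet (hJ : IsPontryaginSpace J κ) (hB : IsSymmetric J B)
    (hs : ¬ ∀ y, ∃ x : B.domain, J (B x) + Complex.I • (x : H) = y) {z : ℂ}
    (hr : z ∈ resolventSet B) : 0 < z.im := by
  by_contra! hz
  apply hs
  suffices h : ∀ y, ∃ x : B.domain,
      J (B x) - ((0 : ℝ) : ℂ) • J x - ((-1 : ℝ) * Complex.I) • (x : H) = y by simpa using h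
  rcases hz.eq_or_lt with h0 | h0
  · obtain ⟨ε, hε, h⟩ := exists_shift_surjective_iff hJ h0 hr.1 (-1) (by simp)
    exact surjective_shift hJ hB z.re 0 (by simpa using hε) (h.1 hr.2)
  · exact surjective_shift hJ hB z.re 0 (by simpa using h0)
      ((surjective_sub_smul_iff hJ hB h0.ne hr.1).1 hr.2)

end Resolvent

/-! ### Algebra of the indefinite form and dissipative operators -/

section Form

variable {H : Type*} [NormedAddCommGroup H] [InnerProductSpace ℂ H] (J : H →L[ℂ] H)

theorem form_add_left (x y z : H) : form J (x + y) z = form J x z + form J y z := by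
  simp [form]

theorem form_add_right (x y z : H) : form J x (y + z) = form J x y + form J x z := by
  simp [form]

theorem form_sub_left (x y z : H) : form J (x - y) z = form J x z - form J y z := by
  simp [form]

theorem form_sub_right (x y z : H) : form J x (y - z) = form J x y - form J x z := by
  simp [form]

theorem form_smul_left (a : ℂ) (x y : H) : form J (a • x) y = a * form J x y := by
  simp [form]

theorem form_smul_right (a : ℂ) (x y : H) :
    form J x (a • y) = (starRingEnd ℂ) a * form J x y := by
  rw [form, form, inner_smul_left]

theorem continuous_form_left (y : H) : Continuous fun x => form J x y := by
  unfold form; fun_prop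

/-- The off-diagonal identity for dissipative operators: if `[S n, n]` is real then
`[S p, n] = [p, S n]` for every `p` in the domain. -/
theorem IsDissipative.form_eq_of_im_eq_zero [CompleteSpace H] {J : H →L[ℂ] H} {κ : ℕ}
    (hJ : IsPontryaginSpace J κ)
    {S : H →ₗ.[ℂ] H} (hS : IsDissipative J S) (n p : S.domain)
    (hn : (form J (S n) n).im = 0) : form J (S p) n = form J p (S n) := by
  by_contra hne
  set w : ℂ := form J (S p) n - form J p (S n) with hw
  have hw0 : 0 < ‖w‖ ^ 2 := by
    have : w ≠ 0 := sub_ne_zero.2 hne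
    positivity
  have hconj : ∀ a : ℂ, (a * form J (S n) p).im = -((starRingEnd ℂ) a * form J p (S n)).im := by
    intro a
    rw [← hJ.form_conj p, ← Complex.conj_im]
    simp
  -- Testing dissipativity on `p + i t w n` makes the quadratic term in `t` vanish, because `[S n,
  -- n]` is real. What remains is affine in `t` with slope `-‖w‖²`, yet nonnegative for all `t`.
  have key : ∀ t : ℝ, 0 ≤ (form J (S p) p).im - t * ‖w‖ ^ 2 := by
    intro t
    set c : ℂ := t * Complex.I * w with hc
    have h := hS (p + c • n)
    have hc' : (starRingEnd ℂ) c * w = -(t * ‖w‖ ^ 2 : ℝ) * Complex.I := by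
      have : (starRingEnd ℂ) w * w = ((‖w‖ ^ 2 : ℝ) : ℂ) := by
        rw [mul_comm, Complex.mul_conj, Complex.normSq_eq_norm_sq]
      rw [hc, map_mul, map_mul, Complex.conj_I, Complex.conj_ofReal, mul_assoc, this]
      push_cast
      ring
    have hww : ((starRingEnd ℂ) c * form J (S p) n).im - ((starRingEnd ℂ) c * form J p (S n)).im
        = -(t * ‖w‖ ^ 2) := by
      rw [← Complex.sub_im, ← mul_sub, ← hw, hc']
      simp [-Complex.ofReal_mul, -Complex.ofReal_pow]
    have hcc : ((starRingEnd ℂ) c * (c * form J (S n) n)).im = 0 := by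
      rw [← mul_assoc, mul_comm ((starRingEnd ℂ) c), Complex.mul_conj, Complex.im_ofReal_mul, hn,
        mul_zero]
    rw [LinearPMap.map_add, LinearPMap.map_smul, Submodule.coe_add, Submodule.coe_smul,
      form_add_left, form_add_right, form_add_right, form_smul_left, form_smul_left,
      form_smul_right, form_smul_right, Complex.add_im, Complex.add_im, Complex.add_im,
      hconj, mul_left_comm c, hcc] at h
    linarith
  have h1 := key (((form J (S p) p).im + 1) / ‖w‖ ^ 2)
  rw [div_mul_cancel₀ _ hw0.ne'] at h1
  linarith

end Form

/-! ### Canonical decompositions, their norms and the strip estimate -/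

namespace CanonicalDecomposition

section Basic

variable {H : Type*} [NormedAddCommGroup H] [InnerProductSpace ℂ H] {J : H →L[ℂ] H}
  (D : CanonicalDecomposition J)

theorem projNeg_add_projPos (x : H) : (D.projNeg x : H) + D.projPos x = x := by
  simpa [projNeg, projPos] using Submodule.projection_add_projection_eq_self D.isCompl x

theorem projNeg_of_mem_neg {x : H} (hx : x ∈ D.neg) : (D.projNeg x : H) = x := by
  rw [projNeg, Submodule.projectionOnto_apply_of_mem_left _ hx]

theorem projPos_of_mem_pos {x : H} (hx : x ∈ D.pos) : (D.projPos x : H) = x := by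
  rw [projPos, Submodule.projectionOnto_apply_of_mem_left _ hx]

theorem projNeg_of_mem_pos {x : H} (hx : x ∈ D.pos) : D.projNeg x = 0 :=
  (Submodule.projectionOnto_apply_eq_zero_iff D.isCompl).2 hx

theorem projPos_of_mem_neg {x : H} (hx : x ∈ D.neg) : D.projPos x = 0 :=
  (Submodule.projectionOnto_apply_eq_zero_iff D.isCompl.symm).2 hx

theorem norm_arg_nonneg (x : H) :
    0 ≤ (form J (D.projPos x) (D.projPos x)).re - (form J (D.projNeg x) (D.projNeg x)).re := by
  have h1 : 0 ≤ (form J (D.projPos x) (D.projPos x)).re := by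
    by_cases h : (D.projPos x : H) = 0
    · simp [h, form]
    · exact (D.pos_def _ (D.projPos x).2 h).le
  have h2 : (form J (D.projNeg x) (D.projNeg x)).re ≤ 0 := by
    by_cases h : (D.projNeg x : H) = 0
    · simp [h, form]
    · exact (D.neg_def _ (D.projNeg x).2 h).le
  linarith

theorem norm_nonneg (x : H) : 0 ≤ D.norm x := Real.sqrt_nonneg _

theorem norm_sq (x : H) : D.norm x ^ 2 =
    (form J (D.projPos x) (D.projPos x)).re - (form J (D.projNeg x) (D.projNeg x)).re :=
  Real.sq_sqrt (D.norm_arg_nonneg x)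

theorem norm_sq_of_mem_neg {x : H} (hx : x ∈ D.neg) : D.norm x ^ 2 = -(form J x x).re := by
  rw [D.norm_sq, D.projNeg_of_mem_neg hx, D.projPos_of_mem_neg hx]
  simp [form]

theorem norm_sq_of_mem_pos {x : H} (hx : x ∈ D.pos) : D.norm x ^ 2 = (form J x x).re := by
  rw [D.norm_sq, D.projPos_of_mem_pos hx, D.projNeg_of_mem_pos hx]
  simp [form]

theorem norm_smul {a : ℂ} (ha : ‖a‖ = 1) (x : H) : D.norm (a • x) = D.norm x := by
  have h : ∀ y : H, form J (a • y) (a • y) = form J y y := by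
    intro y
    rw [form_smul_left, form_smul_right, ← mul_assoc, Complex.mul_conj,
      Complex.normSq_eq_norm_sq, ha]
    simp
  rw [norm, norm, map_smul, map_smul, Submodule.coe_smul, Submodule.coe_smul, h, h]

theorem normMulProjNeg_nonneg {A : H →ₗ.[ℂ] H} (hD : D.neg ≤ A.domain) :
    0 ≤ D.normMulProjNeg A hD :=
  Real.sInf_nonneg fun _ h => h.1

/-- `Π⁻` is the whole indefinite orthogonal complement of `Π⁺`: if `x` is orthogonal to `Π⁺`, then
`[P⁺ x, P⁺ x] = 0`, so `P⁺ x = 0` by definiteness. Such a complement is closed. -/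
theorem isClosed_neg : IsClosed (D.neg : Set H) := by
  have h : (D.neg : Set H) = ⋂ p ∈ D.pos, {x | form J x p = 0} := by
    ext x
    simp only [SetLike.mem_coe, mem_iInter, mem_ofPred_eq]
    refine ⟨fun hx n hn => D.orthogonal x hx n hn, fun h => ?_⟩
    have hx := D.projNeg_add_projPos x
    have h0 := h _ (D.projPos x).2
    have e := congrArg (fun y => form J y (D.projPos x)) hx
    simp only [form_add_left, D.orthogonal _ (D.projNeg x).2 _ (D.projPos x).2, zero_add,
      h0] at e
    have hz : (D.projPos x : H) = 0 := by
      by_contra hne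
      have := D.pos_def _ (D.projPos x).2 hne
      rw [e] at this
      simp at this
    rw [← hx, hz, add_zero]
    exact (D.projNeg x).2
  rw [h]
  exact isClosed_biInter fun n _ => isClosed_eq (continuous_form_left J n) continuous_const

end Basic

variable {H : Type*} [NormedAddCommGroup H] [InnerProductSpace ℂ H] [CompleteSpace H]
  {J : H →L[ℂ] H} {κ : ℕ} (D : CanonicalDecomposition J)

theorem orthogonal_symm (hJ : IsPontryaginSpace J κ) {x y : H} (hx : x ∈ D.pos) (hy : y ∈ D.neg) : form J x y = 0 := by
  rw [← hJ.form_conj, D.orthogonal y hy x hx, map_zero]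

theorem isClosed_pos (hJ : IsPontryaginSpace J κ) : IsClosed (D.pos : Set H) := by
  have h : (D.pos : Set H) = ⋂ n ∈ D.neg, {x | form J x n = 0} := by
    ext x
    simp only [SetLike.mem_coe, mem_iInter, mem_ofPred_eq]
    refine ⟨fun hx n hn => D.orthogonal_symm hJ hx hn, fun h => ?_⟩
    have hx := D.projNeg_add_projPos x
    have h0 := h _ (D.projNeg x).2
    have e := congrArg (fun y => form J y (D.projNeg x)) hx
    simp only [form_add_left, D.orthogonal_symm hJ (D.projPos x).2 (D.projNeg x).2, add_zero,
      h0] at e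
    have hz : (D.projNeg x : H) = 0 := by
      by_contra hne
      have := D.neg_def _ (D.projNeg x).2 hne
      rw [e] at this
      simp at this
    rw [← hx, hz, zero_add]
    exact (D.projPos x).2
  rw [h]
  exact isClosed_biInter fun n _ => isClosed_eq (continuous_form_left J n) continuous_const

/-- The canonical symmetry `P⁺ - P⁻` of the decomposition, as a bounded operator. -/
theorem exists_symmetry (hJ : IsPontryaginSpace J κ) :
    ∃ W : H →L[ℂ] H, ∀ x, W x = D.projPos x - D.projNeg x := by
  have h := Submodule.IsCompl.isTopCompl_of_isClosed D.isCompl D.isClosed_neg (D.isClosed_pos hJ)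
  refine ⟨⟨D.pos.subtype ∘ₗ D.projPos - D.neg.subtype ∘ₗ D.projNeg, ?_⟩, fun x => rfl⟩
  exact (continuous_subtype_val.comp h.symm.continuous_projectionOnto).sub
    (continuous_subtype_val.comp h.continuous_projectionOnto)

/-- The Hilbert inner product `[x, (P⁺ - P⁻) y]` of the decomposition. -/
theorem form_symmetry (hJ : IsPontryaginSpace J κ) (x y : H) :
    form J x (D.projPos y - D.projNeg y) =
      form J (D.projPos x) (D.projPos y) - form J (D.projNeg x) (D.projNeg y) := by
  conv_lhs => rw [← D.projNeg_add_projPos x]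
  rw [form_sub_right, form_add_left, form_add_left,
    D.orthogonal _ (D.projNeg x).2 _ (D.projPos y).2,
    D.orthogonal_symm hJ (D.projPos x).2 (D.projNeg y).2]
  ring

/-- Cauchy–Schwarz for the norm of a canonical decomposition. -/
theorem norm_form_symmetry_le (hJ : IsPontryaginSpace J κ) (x y : H) :
    ‖form J x (D.projPos y - D.projNeg y)‖ ≤ D.norm x * D.norm y := by
  -- The arguments are swapped because `form` is linear in its first slot, the core inner product in
  -- its second.
  let c : PreInnerProductSpace.Core ℂ H :=
    { inner := fun x y => form J y (D.projPos x - D.projNeg x)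
      conj_inner_symm := fun x y => by
        rw [D.form_symmetry hJ, D.form_symmetry hJ, map_sub, hJ.form_conj, hJ.form_conj]
      re_inner_nonneg := fun x => by
        rw [D.form_symmetry hJ]
        exact D.norm_arg_nonneg x
      add_left := fun x y z => by
        rw [← form_add_right, map_add, map_add, Submodule.coe_add, Submodule.coe_add]
        congr 1
        abel
      smul_left := fun x y a => by
        rw [← form_smul_right, map_smul, map_smul, Submodule.coe_smul, Submodule.coe_smul,
          smul_sub] }
  have hself : ∀ z, D.norm z = Real.sqrt (form J z (D.projPos z - D.projNeg z)).re := by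
    intro z
    rw [D.form_symmetry hJ, Complex.sub_re, norm]
  rw [hself, hself, mul_comm]
  exact @InnerProductSpace.Core.norm_inner_le_norm ℂ H _ _ _ c y x

theorem norm_form_le_of_mem_pos (hJ : IsPontryaginSpace J κ) (x : H) {p : H} (hp : p ∈ D.pos) :
    ‖form J x p‖ ≤ D.norm x * D.norm p := by
  have := D.norm_form_symmetry_le hJ x p
  rwa [D.projPos_of_mem_pos hp, D.projNeg_of_mem_pos hp, Submodule.coe_zero, sub_zero] at this

theorem norm_form_le_of_mem_neg (hJ : IsPontryaginSpace J κ) (x : H) {n : H} (hn : n ∈ D.neg) :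
    ‖form J x n‖ ≤ D.norm x * D.norm n := by
  have := D.norm_form_symmetry_le hJ x n
  rwa [D.projNeg_of_mem_neg hn, D.projPos_of_mem_neg hn, Submodule.coe_zero, zero_sub,
    ← neg_one_smul ℂ n, form_smul_right, norm_mul, map_neg, map_one, norm_neg, norm_one,
    one_mul] at this

/-- The norm of a canonical decomposition is dominated by the Hilbert norm. -/
theorem exists_norm_le (hJ : IsPontryaginSpace J κ) : ∃ C : ℝ, 0 < C ∧ ∀ x, D.norm x ≤ C * ‖x‖ := by
  obtain ⟨W, hW⟩ := D.exists_symmetry hJ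
  refine ⟨‖W‖ + 1, by positivity, fun x => ?_⟩
  refine Real.sqrt_le_iff.2 ⟨by positivity, ?_⟩
  rw [← Complex.sub_re, ← D.form_symmetry hJ, ← hW]
  calc (form J x (W x)).re ≤ ‖form J x (W x)‖ := Complex.re_le_norm _
    _ ≤ ‖W x‖ * ‖J x‖ := norm_inner_le_norm _ _
    _ ≤ (‖W‖ * ‖x‖) * ‖x‖ := by
        rw [hJ.norm_map]
        gcongr
        exact W.le_opNorm x
    _ ≤ ((‖W‖ + 1) * ‖x‖) ^ 2 := by
        have := _root_.norm_nonneg W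
        nlinarith [mul_nonneg this (sq_nonneg ‖x‖), sq_nonneg ‖x‖,
          mul_nonneg (sq_nonneg ‖W‖) (sq_nonneg ‖x‖)]

/-- The norm of a canonical decomposition dominates the Hilbert norm. -/
theorem exists_le_norm (hJ : IsPontryaginSpace J κ) : ∃ C : ℝ, 0 < C ∧ ∀ x, ‖x‖ ≤ C * D.norm x := by
  obtain ⟨W, hW⟩ := D.exists_symmetry hJ
  obtain ⟨C, hC, hCn⟩ := D.exists_norm_le hJ
  refine ⟨C * (‖W‖ + 1), by positivity, fun x => ?_⟩
  have hWW : ∀ y, W (W y) = y := by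
    intro y
    have h1 : D.projPos (W y) = D.projPos y := by
      rw [hW, map_sub, D.projPos_of_mem_neg (D.projNeg y).2, sub_zero]
      exact Subtype.ext (D.projPos_of_mem_pos (D.projPos y).2)
    have h2 : D.projNeg (W y) = -D.projNeg y := by
      rw [hW, map_sub, D.projNeg_of_mem_pos (D.projPos y).2, zero_sub, neg_inj]
      exact Subtype.ext (D.projNeg_of_mem_neg (D.projNeg y).2)
    rw [hW, h1, h2, Submodule.coe_neg, sub_neg_eq_add, add_comm, D.projNeg_add_projPos]
  -- As `W² = 1`, this choice turns the left side into `|[x, J x]| = ‖x‖²`.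
  have h := D.norm_form_symmetry_le hJ x (W (J x))
  rw [← hW, hWW, form, inner_self_eq_norm_sq_to_K, hJ.norm_map] at h
  have h' : ‖x‖ ^ 2 ≤ D.norm x * D.norm (W (J x)) := by
    simpa using h
  have h2 : D.norm (W (J x)) ≤ C * ((‖W‖ + 1) * ‖x‖) := by
    refine (hCn _).trans ?_
    gcongr
    refine (W.le_opNorm _).trans ?_
    rw [hJ.norm_map]
    gcongr
    linarith
  rcases (_root_.norm_nonneg x).eq_or_lt with h0 | h0
  · rw [← h0]
    have := D.norm_nonneg x
    positivity
  · have h3 : ‖x‖ ^ 2 ≤ D.norm x * (C * ((‖W‖ + 1) * ‖x‖)) :=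
      h'.trans (mul_le_mul_of_nonneg_left h2 (D.norm_nonneg x))
    rw [sq] at h3
    refine le_of_mul_le_mul_right (h3.trans_eq ?_) h0
    ring

/-- The infimum defining `‖A P⁻‖` is attained. -/
theorem norm_apply_le (hJ : IsPontryaginSpace J κ) {A : H →ₗ.[ℂ] H} (hA : A.IsClosed) (hD : D.neg ≤ A.domain) {n : H}
    (hn : n ∈ D.neg) : D.norm (A ⟨n, hD hn⟩) ≤ D.normMulProjNeg A hD * D.norm n := by
  obtain ⟨C₁, hC₁, h₁⟩ := D.exists_norm_le hJ
  obtain ⟨C₂, hC₂, h₂⟩ := D.exists_le_norm hJ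
  have htop := Submodule.IsCompl.isTopCompl_of_isClosed D.isCompl D.isClosed_neg (D.isClosed_pos hJ)
  have hcont : Continuous D.projNeg := htop.continuous_projectionOnto
  let f : H →ₗ[ℂ] H := A.toFun ∘ₗ Submodule.inclusion hD ∘ₗ D.projNeg
  have hf : ∀ x, f x = A ⟨(D.projNeg x : H), hD (D.projNeg x).2⟩ := fun x => rfl
  -- `A P⁻` is everywhere defined, and its graph is the preimage of the closed graph of `A` under a
  -- continuous map. It is therefore bounded, so the set of admissible constants is nonempty.
  have hgraph : IsClosed (f.graph : Set (H × H)) := by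
    have : (f.graph : Set (H × H)) =
        (fun q : H × H => ((D.projNeg q.1 : H), q.2)) ⁻¹' (A.graph : Set (H × H)) := by
      ext ⟨x, y⟩
      simp only [SetLike.mem_coe, LinearMap.mem_graph_iff, mem_preimage, hf]
      rw [LinearPMap.mem_graph_iff]
      constructor
      · intro h
        exact ⟨⟨(D.projNeg x : H), hD (D.projNeg x).2⟩, rfl, h.symm⟩
      · rintro ⟨v, hv, hv'⟩
        simp only at hv hv'
        rw [← hv']
        congr 1
        exact Subtype.ext hv
    rw [this]
    exact IsClosed.preimage (((continuous_subtype_val.comp hcont).comp continuous_fst).prodMk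
      continuous_snd) hA
  let F : H →L[ℂ] H := ⟨f, f.continuous_of_isClosed_graph hgraph⟩
  have hne : {c : ℝ | 0 ≤ c ∧
      ∀ x : H, D.norm (A ⟨(D.projNeg x : H), hD (D.projNeg x).2⟩) ≤ c * D.norm x}.Nonempty := by
    refine ⟨C₁ * (‖F‖ * C₂), by positivity, fun x => ?_⟩
    rw [← hf]
    calc D.norm (f x) ≤ C₁ * ‖f x‖ := h₁ _
      _ ≤ C₁ * (‖F‖ * ‖x‖) := by gcongr; exact F.le_opNorm x
      _ ≤ C₁ * (‖F‖ * (C₂ * D.norm x)) := by gcongr; exact h₂ x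
      _ = _ := by ring
  have hval : D.norm (A ⟨n, hD hn⟩) = D.norm (f n) := by
    rw [hf]
    congr 3
    exact (D.projNeg_of_mem_neg hn).symm
  rcases (D.norm_nonneg n).eq_or_lt with h0 | h0
  · obtain ⟨c, -, hc⟩ := hne
    have := hc n
    rw [← hf, ← h0, mul_zero] at this
    rw [hval, ← h0, mul_zero]
    exact this
  · rw [← div_le_iff₀ h0]
    refine le_csInf hne ?_
    rintro c ⟨-, hc⟩
    rw [div_le_iff₀ h0, hval]
    exact hc n

/-- If `S` is dissipative, `Π⁻ ⊆ dom S`, the form `[S n, n]` is real on `Π⁻`, and `S` is bounded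
by `a` on `Π⁻`, then all `z` with `Im z < -a` are points of regular type of `S`. -/
theorem mem_regularType (hJ : IsPontryaginSpace J κ) {S : H →ₗ.[ℂ] H} (hS : IsDissipative J S) (hD : D.neg ≤ S.domain)
    (hreal : ∀ n (hn : n ∈ D.neg), (form J (S ⟨n, hD hn⟩) n).im = 0) {a : ℝ}
    (ha : ∀ n (hn : n ∈ D.neg), D.norm (S ⟨n, hD hn⟩) ≤ a * D.norm n) {z : ℂ}
    (hz : a < -z.im) (ha0 : 0 ≤ a) : z ∈ regularType S := by
  obtain ⟨C₁, hC₁, h₁⟩ := D.exists_norm_le hJ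
  obtain ⟨C₂, hC₂, h₂⟩ := D.exists_le_norm hJ
  obtain ⟨η, hη⟩ : ∃ η, η = -z.im := ⟨_, rfl⟩
  rw [← hη] at hz
  have hη0 : 0 < η := ha0.trans_lt hz
  suffices h : ∀ x : S.domain, (η - a) * ‖(x : H)‖ ≤ 2 * C₁ * C₂ * ‖S x - z • (x : H)‖ by
    refine ⟨(η - a) / (2 * C₁ * C₂), div_pos (sub_pos.2 hz) (by positivity), fun x => ?_⟩
    rw [div_mul_eq_mul_div, div_le_iff₀ (by positivity), mul_comm ‖_‖]
    exact h x
  intro x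
  set n : S.domain := ⟨(D.projNeg (x : H) : H), hD (D.projNeg (x : H)).2⟩ with hn
  have hnm : (n : H) ∈ D.neg := (D.projNeg (x : H)).2
  -- The component in `Π⁺` stays in `dom S` because `Π⁻ ⊆ dom S`.
  set p : S.domain := x - n with hp
  have hpv : (p : H) = D.projPos (x : H) := by
    rw [hp, Submodule.coe_sub, sub_eq_iff_eq_add', hn, D.projNeg_add_projPos]
  have hpm : (p : H) ∈ D.pos := by rw [hpv]; exact (D.projPos (x : H)).2
  have hx : x = n + p := by rw [hp, add_sub_cancel]
  have hxv : (x : H) = n + p := congrArg Subtype.val hx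
  set f : H := S x - z • (x : H) with hf
  have hfe : f = S n + S p - (z • (n : H) + z • (p : H)) := by
    rw [hf, hxv, smul_add, hx, LinearPMap.map_add]
  have hSn : D.norm (S n) ≤ a * D.norm n := ha _ hnm
  have hoff := hS.form_eq_of_im_eq_zero hJ n p (hreal _ hnm)
  have hnp := D.orthogonal _ hnm _ hpm
  have hpn := D.orthogonal_symm hJ hpm hnm
  have e1 : form J f p = form J (S n) p + form J (S p) p - z * form J (p : H) p := by
    rw [hfe, form_sub_left, form_add_left, form_add_left, form_smul_left, form_smul_left, hnp]
    ring
  have e2 : form J f n = form J (S n) n + form J p (S n) - z * form J (n : H) n := by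
    rw [hfe, form_sub_left, form_add_left, form_add_left, form_smul_left, form_smul_left, hpn,
      hoff]
    ring
  have npos := D.norm_nonneg (n : H)
  have ppos := D.norm_nonneg (p : H)
  have fpos := D.norm_nonneg f
  -- In `Im [f, p]` the uncontrolled term `Im [S p, p]` and `η ‖p‖²` are both nonnegative, so the
  -- former can be dropped.
  have i1 : η * D.norm p ≤ D.norm f + a * D.norm n := by
    have hi : (form J f p).im = (form J (S n) p).im + (form J (S p) p).im + η * D.norm p ^ 2 := by
      rw [e1, D.norm_sq_of_mem_pos hpm, Complex.sub_im, Complex.add_im, Complex.mul_im,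
        hJ.form_self_im, hη]
      ring
    have b1 := (Complex.abs_im_le_norm _).trans (D.norm_form_le_of_mem_pos hJ f hpm)
    have b2 := (Complex.abs_im_le_norm _).trans (D.norm_form_le_of_mem_pos hJ (S n) hpm)
    have b3 := hS p
    have b4 : D.norm (S n) * D.norm (p : H) ≤ a * D.norm n * D.norm (p : H) := by gcongr
    have b5 : η * D.norm (p : H) * D.norm (p : H) ≤ (D.norm f + a * D.norm n) * D.norm p := by
      linarith [le_abs_self (form J f p).im, neg_abs_le (form J (S n) p).im]
    rcases ppos.eq_or_lt with h0 | h0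
    · rw [← h0, mul_zero]; positivity
    · exact le_of_mul_le_mul_right b5 h0
  -- `[S p, n]`, with `S p` not controlled, has been replaced by `[p, S n]`, which is bounded by `a
  -- ‖n‖ ‖p‖`.
  have i2 : η * D.norm n ≤ D.norm f + a * D.norm p := by
    have hi : (form J f n).im = (form J (p : H) (S n)).im - η * D.norm n ^ 2 := by
      rw [e2, D.norm_sq_of_mem_neg hnm, Complex.sub_im, Complex.add_im, Complex.mul_im,
        hJ.form_self_im, hreal _ hnm, hη]
      ring
    have b1 := (Complex.abs_im_le_norm _).trans (D.norm_form_le_of_mem_neg hJ f hnm)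
    have b2 : |(form J (p : H) (S n)).im| ≤ D.norm (S n) * D.norm p := by
      refine (Complex.abs_im_le_norm _).trans ?_
      rw [← hJ.form_conj, RCLike.norm_conj]
      exact D.norm_form_le_of_mem_pos hJ (S n) hpm
    have b4 : D.norm (S n) * D.norm (p : H) ≤ a * D.norm n * D.norm (p : H) := by gcongr
    have b5 : η * D.norm (n : H) * D.norm (n : H) ≤ (D.norm f + a * D.norm p) * D.norm n := by
      linarith [neg_abs_le (form J f n).im, le_abs_self (form J (p : H) (S n)).im]
    rcases npos.eq_or_lt with h0 | h0
    · rw [← h0, mul_zero]; positivity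
    · exact le_of_mul_le_mul_right b5 h0
  have hsum : (η - a) * (D.norm n + D.norm p) ≤ 2 * D.norm f := by linarith
  have hxn : ‖(x : H)‖ ≤ C₂ * (D.norm n + D.norm p) := by
    rw [hxv, mul_add]
    exact (norm_add_le _ _).trans (add_le_add (h₂ _) (h₂ _))
  calc (η - a) * ‖(x : H)‖ ≤ (η - a) * (C₂ * (D.norm n + D.norm p)) :=
        mul_le_mul_of_nonneg_left hxn (sub_pos.2 hz).le
    _ = C₂ * ((η - a) * (D.norm n + D.norm p)) := by ring
    _ ≤ C₂ * (2 * D.norm f) := by gcongr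
    _ ≤ C₂ * (2 * (C₁ * ‖f‖)) := by gcongr; exact h₁ f
    _ = _ := by ring

end CanonicalDecomposition

/-! ### The set `Γ_A` -/

section Gamma

variable {H : Type*} [NormedAddCommGroup H] [InnerProductSpace ℂ H]
  {J : H →L[ℂ] H} {A B : H →ₗ.[ℂ] H}

theorem isAdmissible_gammaSet : IsAdmissible J A (GammaSet J A) where
  isOpen := isOpen_sUnion fun _ hU => hU.isOpen
  nonReal := sUnion_subset fun _ hU => hU.nonReal
  neg_mem := by
    rintro z ⟨U, hU, hz⟩
    exact ⟨U, hU, hU.neg_mem z hz⟩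
  conj_mem := by
    rintro z ⟨U, hU, hz⟩
    exact ⟨U, hU, hU.conj_mem z hz⟩
  regular := by
    rintro S hAS hS z ⟨hz, U, hU, hzU⟩
    exact hU.regular S hAS hS ⟨hz, hzU⟩
  regular_neg := by
    rintro S hAS hS z ⟨hz, U, hU, hzU⟩
    exact hU.regular_neg S hAS hS ⟨hz, hzU⟩

theorem IsSymmetric.neg (hB : IsSymmetric J B) : IsSymmetric J (-B) := by
  intro x y
  have := hB x y
  simp only [form, LinearPMap.neg_apply, map_neg, inner_neg_left, inner_neg_right] at this ⊢
  rw [this]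

theorem mem_regularType_neg_iff {z : ℂ} : -z ∈ regularType (-B) ↔ z ∈ regularType B := by
  refine exists_congr fun c => and_congr_right fun _ => forall_congr' fun x => ?_
  rw [LinearPMap.neg_apply, neg_smul, ← neg_sub', norm_neg]

variable [CompleteSpace H] {κ : ℕ}

theorem IsSymmetric.isDissipative (hJ : IsPontryaginSpace J κ) (hB : IsSymmetric J B) :
    IsDissipative J B := fun x => (hB.form_self_im hJ x).ge

/-- Non-real points of `Γ_A` are points of regular type of every symmetric extension of `A`. -/
theorem gammaSet_subset_regularType (hJ : IsPontryaginSpace J κ) (hAB : A ≤ B)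
    (hB : IsSymmetric J B) : GammaSet J A ⊆ regularType B := by
  intro z hz
  have hG : IsAdmissible J A (GammaSet J A) := isAdmissible_gammaSet
  rcases lt_or_gt_of_ne (show z.im ≠ 0 from hG.nonReal hz) with h | h
  · exact hG.regular B hAB (hB.isDissipative hJ) ⟨h, hz⟩
  -- In the upper half-plane, `-z ∈ Γ_A` lies in the lower one, and `-B` is a symmetric, hence
  -- dissipative, extension of `-A`.
  · have hAB' : -A ≤ -B := by
      refine ⟨hAB.1, fun x y hxy => ?_⟩
      rw [LinearPMap.neg_apply, LinearPMap.neg_apply, hAB.2 hxy]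
    exact mem_regularType_neg_iff.1 (hG.regular_neg (-B) hAB' (hB.neg.isDissipative hJ)
      ⟨by simpa [lowerHalf] using h, hG.neg_mem z hz⟩)

theorem isAdmissible_of_normMulProjNeg (hJ : IsPontryaginSpace J κ) (hA : A.IsClosed)
    (hsym : IsSymmetric J A) (D : CanonicalDecomposition J) (hD : D.neg ≤ A.domain) {t : ℝ}
    (ht : 1 ≤ t) : IsAdmissible J A {z : ℂ | t * D.normMulProjNeg A hD < |z.im|} := by
  have ha := D.normMulProjNeg_nonneg hD
  have hle : ∀ z : ℂ, t * D.normMulProjNeg A hD < |z.im| → D.normMulProjNeg A hD < |z.im| :=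
    fun z hz => (le_mul_of_one_le_left ha ht).trans_lt hz
  -- The factor `ε = ±1` treats extensions of `A` and of `-A` together; neither the reality of `[S
  -- n, n]` nor the bound on `Π⁻` sees the sign.
  have hext : ∀ S : H →ₗ.[ℂ] H, ∀ ε : ℂ, ‖ε‖ = 1 → ε.im = 0 → IsDissipative J S →
      (∃ h : A.domain ≤ S.domain, ∀ x : A.domain, S ⟨x, h x.2⟩ = ε • A x) →
      lowerHalf ∩ {z : ℂ | t * D.normMulProjNeg A hD < |z.im|} ⊆ regularType S := by
    rintro S ε hε hεi hS ⟨hdom, hSA⟩ z ⟨hz, hzt⟩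
    have hz' : z.im < 0 := hz
    refine D.mem_regularType hJ hS (hD.trans hdom) ?_ ?_ (by
      rw [← abs_of_neg hz']; exact hle z hzt) ha
    · intro n hn
      have h1 := hsym.form_self_im hJ ⟨n, hD hn⟩
      rw [hSA ⟨n, hD hn⟩, form_smul_left, Complex.mul_im, h1, hεi]
      simp
    · intro n hn
      rw [hSA ⟨n, hD hn⟩, D.norm_smul hε]
      exact D.norm_apply_le hJ hA hD hn
  refine ⟨isOpen_lt continuous_const (Complex.continuous_im.abs), ?_, ?_, ?_, ?_, ?_⟩
  · intro z hz
    exact abs_pos.1 (ha.trans_lt (hle z hz))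
  · intro z hz
    simpa using hz
  · intro z hz
    simpa using hz
  · intro S hAS hS
    exact hext S 1 (by simp) (by simp) hS ⟨hAS.1, fun x => by rw [one_smul]; exact (hAS.2 rfl).symm⟩
  · intro S hAS hS
    refine hext S (-1) (by simp) (by simp) hS ⟨hAS.1, fun x => ?_⟩
    rw [neg_one_smul, ← LinearPMap.neg_apply]
    exact (hAS.2 rfl).symm

end Gamma

end Pontryagin

/-! ### The main theorem -/

theorem mainTheorem11 {H : Type*} [NormedAddCommGroup H] [InnerProductSpace ℂ H] [CompleteSpace H]
    [TopologicalSpace.SeparableSpace H]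
    (J : H →L[ℂ] H) (κ : ℕ) (hJ : Pontryagin.IsPontryaginSpace J κ)
    (A : H →ₗ.[ℂ] H) (hA : Pontryagin.ClassLP J A)
    (D : Pontryagin.CanonicalDecomposition J) (hD : D.neg ≤ A.domain) :
    Pontryagin.IsAdmissible J A (Pontryagin.GammaSet J A) ∧
    (∀ t₀ : ℝ, |t₀ - 1.84| ≤ 0.005 →
      {z : ℂ | t₀ * D.normMulProjNeg A hD < |z.im|} ⊆ Pontryagin.GammaSet J A) ∧
    ∀ B : H →ₗ.[ℂ] H, A ≤ B → B.IsClosed → Pontryagin.IsMaximalSymmetric J B →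
      1 ≤ Pontryagin.defectPlus J B → Pontryagin.defectMinus J B = 0 →
      Pontryagin.realLine ∩ Pontryagin.resolventSet B =
          Pontryagin.realLine ∩ Pontryagin.regularType B ∧
        Pontryagin.upperHalf ∩ Pontryagin.GammaSet J A ⊆
          Pontryagin.upperHalf ∩ Pontryagin.resolventSet B ∧
        Pontryagin.lowerHalf ∩ Pontryagin.resolventSet B ⊆
          Pontryagin.lowerHalf ∩ Pontryagin.CSet J A ∧
        Pontryagin.resolventSet B ∩ Pontryagin.conjSet (Pontryagin.resolventSet B) = ∅ := by
  refine ⟨Pontryagin.isAdmissible_gammaSet, ?_, ?_⟩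
  · intro t₀ ht
    have ht' : 1 ≤ t₀ := by
      have := (abs_le.1 ht).1
      linarith
    exact subset_sUnion_of_mem (Pontryagin.isAdmissible_of_normMulProjNeg hJ hA.isClosed
      hA.isSymmetric D hD ht')
  · intro B hAB hBc hBm hdp hdm
    have hB := hBm.1
    have hplus := Pontryagin.surjective_of_defectMinus_eq_zero hJ hB hBc hdm
    have hminus := Pontryagin.not_surjective_of_defectPlus hJ hdp
    have hG := Pontryagin.gammaSet_subset_regularType hJ hAB hB
    have him := fun {z : ℂ} => Pontryagin.im_pos_of_mem_resolventSet (z := z) hJ hB hminus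
    refine ⟨?_, ?_, ?_, ?_⟩
    · ext z
      refine and_congr_right fun hz => ⟨fun h => h.1, fun h => ?_⟩
      exact Pontryagin.mem_resolventSet_of_mem_regularType hJ hB hplus
        (show z.im = 0 from hz).ge h
    · rintro z ⟨hz, hzG⟩
      exact ⟨hz, Pontryagin.mem_resolventSet_of_mem_regularType hJ hB hplus
        (show 0 < z.im from hz).le (hG hzG)⟩
    -- The left side is empty: `ρ(B)` lies in the open upper half-plane. This also makes `ρ(B)` and
    -- its conjugate disjoint.
    · rintro z ⟨hz, hzr⟩
      exact absurd (him hzr) (show z.im < 0 from hz).not_gt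
    · rw [eq_empty_iff_forall_notMem]
      rintro z ⟨hz, hzc⟩
      have h1 := him hz
      have h2 := him (show (starRingEnd ℂ) z ∈ Pontryagin.resolventSet B from hzc)
      rw [Complex.conj_im] at h2
      linarith
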